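/- For $n\ge 1$ let $\Pi(n)$ be the set of partitions of $[n]=\{1,\dots,n\}$ into nonempty blocks, let $B_n$ denote the $n$th Bell number (so $B_n=|\Pi(n)|$ and $B_0=1$), and let $\lambda$ be chosen uniformly at random from $\Pi(n)$. Number the blocks of $\lambda$ by $1,2,3,\dots$ in increasing order of their least elements, and code $\lambda$ by the sequence $x_1,\dots,x_n$ in which $x_i$ is the number of the block containing $i$. Let $$L(\lambda)=\bigl|\{\,i : 1\le i\le n-1,\ x_{i+1}=x_i\,\}\bigr|$$ be the number of levels of $\lambda$. Then for every $n\ge 1$ $$\mu_n=\mathbb E(L(\lambda))=(n-1)\frac{B_{n-1}}{B_n},$$ $$\sigma_n^2=\operatorname{Var}(L(\lambda))=(n-1)\frac{B_{n-1}}{B_n}+(n-1)(n-2)\frac{B_{n-2}}{B_n}-(n-1)^2\frac{B_{n-1}^2}{B_n^2}$$ (for $n=1$ the middle term of the variance is read as $0$), and, as $n\to\infty$, $$\mu_n\sim\log n,\qquad \sigma_n^2\sim\log n .$$ Moreover, for every fixed real $x$, $$\mathbf P\left(\frac{L(\lambda)-\mu_n}{\sigma_n}\le x\right)\longrightarrow\frac1{\sqrt{2\pi}}\int_{-\infty}^x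 e^{-\tau^2/2}\,d\tau\qquad(n\to\infty).$$ -/

import Mathlib

open MeasureTheory ProbabilityTheory Filter Topology Asymptotics

/-- The set `Π(n)` of partitions of the set `[n] = {1, …, n}` into nonempty blocks. -/
abbrev SetPartition (n : ℕ) : Type := Finpartition (Finset.Icc 1 n)

/-- All sets of partitions of `[n]` are events. -/
instance SetPartition.instMeasurableSpace (n : ℕ) : MeasurableSpace (SetPartition n) := ⊤

namespace SetPartition

/-- The restricted growth coding `x₁, …, xₙ` of a set partition: number the blocks `1, 2, 3, …` in
increasing order of their least elements; then `xᵢ` is the number of the block that contains `i`,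
i.e. the number of blocks whose least element is at most the least element of the block of `i`.
For example `135|24|6|7` is coded as `1, 2, 1, 2, 1, 3, 4`. -/
def code {n : ℕ} (p : SetPartition n) (i : ℕ) : ℕ :=
  (p.parts.filter fun b => b.min ≤ (p.part i).min).card

/-- The number of levels `L(p)`: the number of `i` with `1 ≤ i ≤ n - 1` and `xᵢ₊₁ = xᵢ`. -/
def levels {n : ℕ} (p : SetPartition n) : ℕ :=
  ((Finset.Ico 1 n).filter fun i => p.code (i + 1) = p.code i).card

/-- The law of a uniformly random partition of `[n]`. -/
noncomputable def uniform (n : ℕ) : Measure (SetPartition n) := uniformOn Set.univ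

/-- The mean `𝔼 L` of the number of levels of a uniformly random partition of `[n]`. -/
noncomputable def levelsMean (n : ℕ) : ℝ := ∫ p : SetPartition n, (p.levels : ℝ) ∂(uniform n)

/-- The variance of the number of levels of a uniformly random partition of `[n]`. -/
noncomputable def levelsVar (n : ℕ) : ℝ :=
  variance (fun p : SetPartition n => (p.levels : ℝ)) (uniform n)

end SetPartition

/-!
Removing the largest element of a partition of `[n + 1]` shows that a partition of `[n]` with `b`
blocks has one extension with an additional level, `b - 1` extensions with the same levels and the
same number of blocks, and one extension with an additional block (`SetPartition.sum_succ`). The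
sums `∑ⱼ (j + c) ^ m / j!` satisfy the same recurrence, which gives, with `n = N + 1`,
`e ∑_λ z ^ L(λ) = ∑ⱼ (j + z) ^ N / j!` (`SetPartition.sum_pow_levels`); at `z = 1` this is
Dobiński's formula. The binomial moments of `L`, and with them the mean and the variance, are the
coefficients of this identity in powers of `z - 1` (`SetPartition.sum_choose_levels`).

Write `j + z = (j + 1) (1 + (z - 1) / (j + 1))`: the number of levels is a mixture of binomial laws
`Bin(N, 1 / (J + 1))`, where `J` has weights proportional to `(j + 1) ^ N / j!`. The mean of
`1 / (J + 1)` is `1 / r` for the ratio `r = B_{N+1} / B_N`, and its variance is a difference of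
ratios of Bell numbers.

These ratios are controlled as follows. They increase (`bellRatio_le_succ`), by steps of at most `1`
(`bellRatio_succ_le`). Moreover `(1 + 1 / r) ^ N ≤ r` by monotonicity of the ratios, and
`(1 - 1 / r) ^ N ≤ 1 / r` by Jensen's inequality, so that `(r - 1) log r ≤ N ≤ (r + 1) log r`. Hence
`N / r ~ log N`, and the variance of `N / (J + 1)` tends to `0` (`tendsto_sq_mul_invVariance`).

So `L` has mean and variance asymptotic to `log n`. Since `w ↦ w ^ N` is `N`-Lipschitz on the unit
disc, the characteristic function of `L` is close to that of the single law `Bin(N, 1 / r)`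
(`SetPartition.norm_sum_pow_levels_sub_le`), for which the central limit theorem is a second order
Taylor expansion (`tendsto_binomial_charFun`). Lévy's continuity theorem and the portmanteau theorem
finish the proof.
-/

/-! ### Inserting an element into a partition -/

namespace Finpartition

variable {α : Type*} [DecidableEq α] {s t : Finset α} {a : α}

/-- The partition of `s ∪ {a}` obtained from a partition `p` of `s` by adding the new element `a` to
the block `B` of `p`; the choice `B = ∅` makes `{a}` a block of its own. -/
def insertInto (p : Finpartition s) (ha : a ∉ s) (ht : t = insert a s) (B : Finset α)
    (hB : B ∈ insert ∅ p.parts) : Finpartition t :=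
  ofExistsUnique (insert (insert a B) (p.parts.erase B))
    (by
      subst ht
      intro b hb
      have hsub : ∀ c ∈ p.parts, c ⊆ s := fun c hc => p.subset hc
      grind)
    (by
      subst ht
      intro x hx
      have hsub : ∀ c ∈ p.parts, c ⊆ s := fun c hc => p.subset hc
      by_cases hxa : x = a
      · subst hxa
        exact ⟨insert x B, by grind, by grind⟩
      · obtain ⟨b, ⟨hb, hxb⟩, -⟩ := p.existsUnique_mem (show x ∈ s by grind)
        have huniq : ∀ c ∈ p.parts, x ∈ c → c = b := fun c hc hxc =>
          p.eq_of_mem_parts hc hb hxc hxb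
        by_cases hbB : b = B
        · exact ⟨insert a B, by grind, by grind⟩
        · exact ⟨b, by grind, by grind⟩)
    (by
      have := p.empty_notMem_parts
      have := Finset.insert_ne_empty a B
      grind)

variable (p : Finpartition s) (ha : a ∉ s) (ht : t = insert a s)

lemma parts_insertInto {B : Finset α} (hB : B ∈ insert ∅ p.parts) :
    (p.insertInto ha ht B hB).parts = insert (insert a B) (p.parts.erase B) := rfl

lemma card_parts_insertInto {B : Finset α} (hB : B ∈ insert ∅ p.parts) :
    (p.insertInto ha ht B hB).parts.card = p.parts.card + if B = ∅ then 1 else 0 := by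
  have hsub : ∀ c ∈ p.parts, c ⊆ s := fun c hc => p.subset hc
  have h0 := p.empty_notMem_parts
  rw [parts_insertInto, Finset.card_insert_of_notMem (by grind)]
  split_ifs with h
  · subst h
    rw [Finset.erase_eq_of_notMem h0]
  · have : B ∈ p.parts := by grind
    rw [Finset.card_erase_add_one this, add_zero]

/-- Every partition of `s ∪ {a}` arises from exactly one partition of `s` by inserting `a` into
exactly one of its blocks, the empty set included. -/
lemma bijective_insertInto :
    Function.Bijective fun x : (Σ p : Finpartition s, {B // B ∈ insert ∅ p.parts}) =>
      x.1.insertInto ha ht x.2.1 x.2.2 := by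
  have hsub : ∀ p : Finpartition s, ∀ c ∈ p.parts, a ∉ c :=
    fun p c hc hac => ha (p.subset hc hac)
  constructor
  · rintro ⟨p, B, hB⟩ ⟨p', B', hB'⟩ h
    have hparts : insert (insert a B) (p.parts.erase B) = insert (insert a B') (p'.parts.erase B') :=
      congrArg Finpartition.parts h
    have h1 := hsub p
    have h2 := hsub p'
    have h3 := p.empty_notMem_parts
    have h4 := p'.empty_notMem_parts
    have haB : a ∉ B := by grind
    have haB' : a ∉ B' := by grind
    have hBB : insert a B = insert a B' := by
      have : insert a B ∈ insert (insert a B') (p'.parts.erase B') := by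
        rw [← hparts]; exact Finset.mem_insert_self _ _
      grind
    have hB_eq : B = B' := by
      rw [← Finset.erase_insert haB, hBB, Finset.erase_insert haB']
    subst hB_eq
    have hp : p = p' := by
      ext c
      have hc : c ∈ insert (insert a B) (p.parts.erase B) ↔
        c ∈ insert (insert a B) (p'.parts.erase B) := by rw [hparts]
      grind
    subst hp
    rfl
  · intro q
    have hat : a ∈ t := by grind
    set A := q.part a with hA
    have hAq : A ∈ q.parts := q.part_mem.2 hat
    have haA : a ∈ A := q.mem_part_self.2 hat
    have huniq : ∀ c ∈ q.parts, a ∈ c → c = A := fun c hc hac =>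
      q.eq_of_mem_parts hc hAq hac haA
    have hq0 := q.empty_notMem_parts
    have hqsub : ∀ c ∈ q.parts, c ⊆ t := fun c hc => q.subset hc
    let P := (insert (A.erase a) (q.parts.erase A)).erase ∅
    let p : Finpartition s := ofExistsUnique P
      (by
        intro b hb x hx
        have h1 := hqsub A hAq
        have h2 := hqsub b
        have : x ∈ t := by grind
        have : x ≠ a := by grind
        grind)
      (by
        intro x hx
        obtain ⟨b, ⟨hb, hxb⟩, -⟩ := q.existsUnique_mem (show x ∈ t by grind)
        have hxb' : ∀ c ∈ q.parts, x ∈ c → c = b := fun c hc hxc =>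
          q.eq_of_mem_parts hc hb hxc hxb
        by_cases hbA : b = A
        · exact ⟨A.erase a, by grind, by grind⟩
        · exact ⟨b, by grind, by grind⟩)
      (by grind)
    have hpP : p.parts = P := rfl
    refine ⟨⟨p, A.erase a, ?_⟩, ?_⟩
    · rw [hpP]
      by_cases h : A.erase a = ∅ <;> grind
    · have hdis : A.erase a ∉ q.parts := by
        intro hmem
        by_cases h : (A.erase a).Nonempty
        · obtain ⟨x, hx⟩ := h
          have := q.eq_of_mem_parts hmem hAq hx (Finset.mem_of_mem_erase hx)
          grind
        · grind
      ext c
      simp only [parts_insertInto, hpP, P]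
      rw [Finset.insert_erase haA]
      grind

end Finpartition

namespace SetPartition

/-- Two elements have the same code exactly when they lie in a common block. -/
lemma code_eq_iff {n : ℕ} (p : SetPartition n) {i j : ℕ} (hi : i ∈ Finset.Icc 1 n)
    (hj : j ∈ Finset.Icc 1 n) : p.code j = p.code i ↔ ∃ b ∈ p.parts, i ∈ b ∧ j ∈ b := by
  rw [← Finpartition.mem_part_iff_exists, Finpartition.mem_part_iff_part_eq_part _ hi hj]
  constructor
  · -- blocks with different minima have different numbers
    have key : ∀ i ∈ Finset.Icc 1 n, ∀ j ∈ Finset.Icc 1 n, (p.part i).min < (p.part j).min →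
        p.code i < p.code j := by
      intro i hi j hj hij
      refine Finset.card_lt_card (Finset.ssubset_iff_of_subset ?_ |>.2 ⟨p.part j, ?_, ?_⟩)
      · exact Finset.monotone_filter_right _ fun b _ hb => hb.trans hij.le
      · exact Finset.mem_filter.2 ⟨p.part_mem.2 hj, le_rfl⟩
      · exact fun h => (Finset.mem_filter.1 h).2.not_gt hij
    intro h
    have hmin : (p.part i).min = (p.part j).min := by
      rcases lt_trichotomy (p.part i).min (p.part j).min with hlt | heq | hgt
      · exact absurd h (key i hi j hj hlt).ne'
      · exact heq
      · exact absurd h (key j hj i hi hgt).ne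
    obtain ⟨x, hx⟩ := Finset.min_of_mem (p.mem_part_self.2 hi)
    exact p.eq_of_mem_parts (p.part_mem.2 hi) (p.part_mem.2 hj) (Finset.mem_of_min hx)
      (Finset.mem_of_min (hmin ▸ hx))
  · intro h
    simp only [code, h]

lemma levels_eq {n : ℕ} (p : SetPartition n) :
    p.levels = ((Finset.Ico 1 n).filter fun i => ∃ b ∈ p.parts, i ∈ b ∧ i + 1 ∈ b).card := by
  refine congrArg Finset.card (Finset.filter_congr fun i hi => ?_)
  rw [Finset.mem_Ico] at hi
  exact p.code_eq_iff (by simp; omega) (by simp; omega)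

lemma notMem_Icc_succ (n : ℕ) : n + 1 ∉ Finset.Icc 1 n := by simp

lemma Icc_succ_eq (n : ℕ) : Finset.Icc 1 (n + 1) = insert (n + 1) (Finset.Icc 1 n) := by
  ext; simp; omega

/-- Inserting `n + 1` creates one new level if it joins the block of `n`, and none otherwise. -/
lemma levels_insertInto {n : ℕ} (hn : 1 ≤ n) (p : SetPartition n) {B : Finset ℕ}
    (hB : B ∈ insert ∅ p.parts) :
    levels (p.insertInto (notMem_Icc_succ n) (Icc_succ_eq n) B hB) =
      p.levels + if n ∈ B then 1 else 0 := by
  have hsub : ∀ c ∈ p.parts, ∀ x ∈ c, x ≤ n := fun c hc x hx => by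
    have := p.subset hc hx
    simp at this; omega
  have hIco : Finset.Ico 1 (n + 1) = insert n (Finset.Ico 1 n) := by
    ext; simp; omega
  have hlast : (∃ b ∈ insert (insert (n + 1) B) (p.parts.erase B), n ∈ b ∧ n + 1 ∈ b) ↔ n ∈ B := by
    constructor
    · rintro ⟨b, hb, h1, h2⟩
      have := hsub b
      grind
    · intro h
      exact ⟨insert (n + 1) B, by grind, by grind, by grind⟩
  have hold : ∀ i ∈ Finset.Ico 1 n,
      (∃ b ∈ insert (insert (n + 1) B) (p.parts.erase B), i ∈ b ∧ i + 1 ∈ b) ↔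
        ∃ b ∈ p.parts, i ∈ b ∧ i + 1 ∈ b := by
    intro i hi
    rw [Finset.mem_Ico] at hi
    constructor
    · rintro ⟨b, hb, h1, h2⟩
      by_cases hbB : b = insert (n + 1) B
      · exact ⟨B, by grind, by grind, by grind⟩
      · exact ⟨b, by grind, h1, h2⟩
    · rintro ⟨b, hb, h1, h2⟩
      by_cases hbB : b = B
      · exact ⟨insert (n + 1) B, by grind, by grind, by grind⟩
      · exact ⟨b, by grind, h1, h2⟩
  rw [levels_eq, levels_eq, Finpartition.parts_insertInto, hIco, Finset.filter_insert,
    Finset.filter_congr hold]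
  by_cases h : n ∈ B
  · rw [if_pos (hlast.2 h), if_pos h, Finset.card_insert_of_notMem (by simp)]
  · rw [if_neg (hlast.not.2 h), if_neg h, add_zero]

/-- Summation over the partitions of `[n + 1]` according to the place of `n + 1`: in the block of
`n`, in one of the other blocks, or in a block of its own. -/
lemma sum_succ {M : Type*} [CommRing M] {n : ℕ} (hn : 1 ≤ n) (g : ℕ → ℕ → M) :
    ∑ q : SetPartition (n + 1), g q.parts.card q.levels =
      ∑ p : SetPartition n, (g p.parts.card (p.levels + 1) +
        ((p.parts.card : M) - 1) * g p.parts.card p.levels + g (p.parts.card + 1) p.levels) := by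
  rw [← Fintype.sum_bijective _
    (Finpartition.bijective_insertInto (notMem_Icc_succ n) (Icc_succ_eq n)) _ _ (fun _ => rfl),
    Fintype.sum_sigma]
  refine Finset.sum_congr rfl fun (p : SetPartition n) _ => ?_
  have hnmem : n ∈ Finset.Icc 1 n := by simp [hn]
  have hA : p.part n ∈ p.parts := p.part_mem.2 hnmem
  have hiff : ∀ B ∈ p.parts, n ∈ B ↔ B = p.part n := fun B hB => by
    rw [eq_comm, p.part_eq_iff_mem hB]
  calc _ = ∑ B : {B // B ∈ insert ∅ p.parts}, g (p.parts.card + if B.1 = ∅ then 1 else 0)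
        (levels p + if n ∈ B.1 then 1 else 0) := by
        refine Finset.sum_congr rfl fun B _ => ?_
        rw [levels_insertInto hn, Finpartition.card_parts_insertInto]
    _ = ∑ B ∈ insert ∅ p.parts, g (p.parts.card + if B = ∅ then 1 else 0)
        (levels p + if n ∈ B then 1 else 0) :=
      Finset.sum_coe_sort (insert ∅ p.parts) fun B : Finset ℕ =>
        g (p.parts.card + if B = ∅ then 1 else 0) (p.levels + if n ∈ B then 1 else 0)
    _ = _ := by
      rw [Finset.sum_insert p.empty_notMem_parts, ← Finset.add_sum_erase _ _ hA,
        Finset.sum_congr rfl (g := fun _ => g p.parts.card (levels p)), Finset.sum_const,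
        Finset.card_erase_of_mem hA, nsmul_eq_mul, Nat.cast_sub, Nat.cast_one]
      · have h1 : n ∈ p.part n := p.mem_part_self.2 hnmem
        have h2 : p.part n ≠ ∅ := p.ne_empty hA
        simp [h1, h2]
        ring
      · exact Finset.card_pos.2 ⟨_, hA⟩
      · intro B hB
        rw [Finset.mem_erase] at hB
        simp [hiff B hB.2, hB.1, p.ne_empty hB.2]

end SetPartition

/-! ### Dobiński sums and the generating function of the levels -/

/-- The exponential moment sum `∑ⱼ (j + c) ^ m / j!`, that is `e` times the `m`-th moment of `J + c`
for a Poisson variable `J` of mean `1`. -/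
noncomputable def dobinskiSum (m : ℕ) (c : ℂ) : ℂ :=
  ∑' j : ℕ, ((j : ℂ) + c) ^ m / (j.factorial : ℂ)

lemma hasSum_dobinskiSum_zero (c : ℂ) :
    HasSum (fun j : ℕ => ((j : ℂ) + c) ^ 0 / (j.factorial : ℂ)) (Complex.exp 1) := by
  have h := NormedSpace.expSeries_div_hasSum_exp (1 : ℂ)
  rw [← Complex.exp_eq_exp_ℂ] at h
  simpa using h

/-- Splitting off one factor `j + c` and shifting the index in the part that carries `j`. -/
lemma HasSum.dobinski_succ {m : ℕ} {c x y : ℂ}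
    (hx : HasSum (fun j : ℕ => ((j : ℂ) + c) ^ m / (j.factorial : ℂ)) x)
    (hy : HasSum (fun j : ℕ => ((j : ℂ) + (c + 1)) ^ m / (j.factorial : ℂ)) y) :
    HasSum (fun j : ℕ => ((j : ℂ) + c) ^ (m + 1) / (j.factorial : ℂ)) (c * x + y) := by
  have h1 : HasSum (fun j : ℕ => (j : ℂ) * ((j : ℂ) + c) ^ m / (j.factorial : ℂ)) y := by
    rw [← hasSum_nat_add_iff' 1]
    simp only [Finset.range_one, Finset.sum_singleton, Nat.cast_zero, zero_mul, zero_div, sub_zero]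
    refine hy.congr_fun fun j => ?_
    rw [Nat.factorial_succ]
    have : (j.factorial : ℂ) ≠ 0 := by exact_mod_cast j.factorial_ne_zero
    have : (j : ℂ) + 1 ≠ 0 := by exact_mod_cast j.succ_ne_zero
    push_cast
    field_simp
    ring
  refine ((hx.mul_left c).add h1).congr_fun fun j => ?_
  ring

lemma summable_dobinski (m : ℕ) (c : ℂ) :
    Summable fun j : ℕ => ((j : ℂ) + c) ^ m / (j.factorial : ℂ) := by
  induction m generalizing c with
  | zero => exact (hasSum_dobinskiSum_zero c).summable
  | succ m ih => exact ((ih c).hasSum.dobinski_succ (ih (c + 1)).hasSum).summable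

lemma hasSum_dobinskiSum (m : ℕ) (c : ℂ) :
    HasSum (fun j : ℕ => ((j : ℂ) + c) ^ m / (j.factorial : ℂ)) (dobinskiSum m c) :=
  (summable_dobinski m c).hasSum

@[simp]
lemma dobinskiSum_zero (c : ℂ) : dobinskiSum 0 c = Complex.exp 1 :=
  (hasSum_dobinskiSum_zero c).tsum_eq

lemma dobinskiSum_succ (m : ℕ) (c : ℂ) :
    dobinskiSum (m + 1) c = c * dobinskiSum m c + dobinskiSum m (c + 1) :=
  ((hasSum_dobinskiSum m c).dobinski_succ (hasSum_dobinskiSum m (c + 1))).tsum_eq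

lemma dobinskiSum_add (m : ℕ) (c u : ℂ) :
    dobinskiSum m (c + u) =
      ∑ k ∈ Finset.range (m + 1), u ^ k * dobinskiSum (m - k) c * (m.choose k : ℂ) := by
  refine HasSum.tsum_eq ?_
  have h := hasSum_sum (s := Finset.range (m + 1)) fun k _ =>
    ((hasSum_dobinskiSum (m - k) c).mul_left (u ^ k)).mul_right (m.choose k : ℂ)
  refine h.congr_fun fun j => ?_
  rw [← add_assoc, add_comm _ u, add_pow, Finset.sum_div]
  exact Finset.sum_congr rfl fun k _ => by ring

/-- **Dobiński's formula**: `e * Bₘ = ∑ⱼ j ^ m / j!`. -/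
lemma dobinskiSum_zero_right (m : ℕ) : dobinskiSum m 0 = Complex.exp 1 * (m.bell : ℂ) := by
  induction m using Nat.strong_induction_on with
  | _ m ih =>
    rcases m with _ | m
    · simp
    · rw [dobinskiSum_succ, zero_mul, zero_add, dobinskiSum_add, Nat.bell_succ,
        ← Nat.range_succ_eq_Iic, Nat.cast_sum, Finset.mul_sum]
      refine Finset.sum_congr rfl fun k _ => ?_
      rw [ih (m - k) (by omega)]
      push_cast
      ring

lemma dobinskiSum_one_right (m : ℕ) : dobinskiSum m 1 = Complex.exp 1 * ((m + 1).bell : ℂ) := by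
  have h := dobinskiSum_succ m 0
  rw [zero_mul, zero_add, zero_add, dobinskiSum_zero_right] at h
  exact h.symm

lemma hasSum_pow_div_factorial (m : ℕ) :
    HasSum (fun j : ℕ => (j : ℝ) ^ m / (j.factorial : ℝ)) (Real.exp 1 * (m.bell : ℝ)) := by
  have h := hasSum_dobinskiSum m 0
  rw [dobinskiSum_zero_right] at h
  simp only [add_zero] at h
  refine Complex.hasSum_ofReal.1 ?_
  simpa using h

lemma hasSum_succ_pow_div_factorial (m : ℕ) :
    HasSum (fun j : ℕ => ((j : ℝ) + 1) ^ m / (j.factorial : ℝ))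
      (Real.exp 1 * ((m + 1).bell : ℝ)) := by
  have h := hasSum_dobinskiSum m 1
  rw [dobinskiSum_one_right] at h
  refine Complex.hasSum_ofReal.1 ?_
  simpa using h

namespace SetPartition

instance instUniqueOne : Unique (SetPartition 1) :=
  IsAtom.uniqueFinpartition (P := Finpartition.indiscrete (by simp)) (by simp)

lemma levels_one (p : SetPartition 1) : p.levels = 0 := by simp [levels]

lemma card_parts_one (p : SetPartition 1) : p.parts.card = 1 := by
  apply le_antisymm
  · simpa using p.card_parts_le_card
  · exact Finset.card_pos.2 (p.parts_nonempty (by simp))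

/-- The generating function of the number of levels, refined by the number of blocks. -/
lemma sum_pow_levels_mul_dobinskiSum (N m : ℕ) (u : ℂ) :
    ∑ p : SetPartition (N + 1), (1 + u) ^ p.levels * dobinskiSum m (p.parts.card + u) =
      dobinskiSum (N + m) (1 + u) := by
  induction N generalizing m with
  | zero => simp [levels_one, card_parts_one]
  | succ N ih =>
    rw [sum_succ (Nat.le_add_left 1 N) fun b l => (1 + u) ^ l * dobinskiSum m (b + u),
      show N + 1 + m = N + (m + 1) by ring, ← ih]
    refine Finset.sum_congr rfl fun p _ => ?_
    rw [dobinskiSum_succ]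
    push_cast
    rw [show (p.parts.card : ℂ) + 1 + u = p.parts.card + u + 1 by ring]
    ring

/-- The generating function of the number of levels is a moment of a shifted Poisson variable. -/
lemma sum_pow_levels (N : ℕ) (u : ℂ) :
    Complex.exp 1 * ∑ p : SetPartition (N + 1), (1 + u) ^ p.levels = dobinskiSum N (1 + u) := by
  have h := sum_pow_levels_mul_dobinskiSum N 0 u
  simp only [dobinskiSum_zero, add_zero] at h
  rw [← h, Finset.mul_sum]
  exact Finset.sum_congr rfl fun p _ => mul_comm _ _

lemma sum_pow_levels_eq_sum_bell (N : ℕ) (u : ℂ) :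
    ∑ p : SetPartition (N + 1), (1 + u) ^ p.levels =
      ∑ k ∈ Finset.range (N + 1), (N.choose k : ℂ) * ((N - k + 1).bell : ℂ) * u ^ k := by
  refine mul_left_cancel₀ (Complex.exp_ne_zero 1) ?_
  rw [sum_pow_levels, dobinskiSum_add, Finset.mul_sum]
  refine Finset.sum_congr rfl fun k _ => ?_
  rw [dobinskiSum_one_right]
  ring

/-- The binomial moments of the number of levels: choosing `k` levels leaves `B_{N + 1 - k}`
partitions, obtained by contracting them. -/
lemma sum_choose_levels (N k : ℕ) :
    ∑ p : SetPartition (N + 1), (p.levels.choose k : ℝ) =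
      (N.choose k : ℝ) * ((N - k + 1).bell : ℝ) := by
  have hpoly : ∑ p : SetPartition (N + 1), (1 + Polynomial.X : Polynomial ℂ) ^ p.levels =
      ∑ k ∈ Finset.range (N + 1),
        Polynomial.C ((N.choose k : ℂ) * ((N - k + 1).bell : ℂ)) * Polynomial.X ^ k := by
    refine Polynomial.funext fun u => ?_
    simpa [Polynomial.eval_finsetSum] using sum_pow_levels_eq_sum_bell N u
  have h := congrArg (fun P => Polynomial.coeff P k) hpoly
  simp only [Polynomial.finsetSum_coeff, Polynomial.coeff_one_add_X_pow,
    Polynomial.coeff_C_mul_X_pow] at h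
  rw [Finset.sum_ite_eq] at h
  split_ifs at h with hk
  · exact_mod_cast h
  · rw [Nat.choose_eq_zero_of_lt (by simpa using hk), Nat.cast_zero, zero_mul]
    exact_mod_cast h

/-- There are `Bₙ` partitions of `[n]`. -/
lemma card_eq_bell (N : ℕ) : Fintype.card (SetPartition (N + 1)) = (N + 1).bell := by
  have h := sum_choose_levels N 0
  simp only [Nat.choose_zero_right, Nat.cast_one, Finset.sum_const, Finset.card_univ, nsmul_eq_mul,
    mul_one, one_mul, Nat.sub_zero] at h
  exact_mod_cast h

end SetPartition

/-! ### Ratios of consecutive Bell numbers -/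

lemma Nat.bell_pos (n : ℕ) : 0 < n.bell := by
  rcases n with _ | n
  · simp
  · rw [Nat.bell_succ]
    refine Finset.sum_pos' (fun _ _ => Nat.zero_le _) ⟨n, by simp, ?_⟩
    simp

/-- The ratio `Bₙ₊₁ / Bₙ` of consecutive Bell numbers. -/
noncomputable def bellRatio (n : ℕ) : ℝ := ((n + 1).bell : ℝ) / (n.bell : ℝ)

lemma cast_bell_pos (n : ℕ) : (0 : ℝ) < (n.bell : ℝ) := Nat.cast_pos.2 n.bell_pos

lemma bellRatio_pos (n : ℕ) : 0 < bellRatio n := div_pos (cast_bell_pos _) (cast_bell_pos _)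

lemma bellRatio_mul_bell (n : ℕ) : bellRatio n * (n.bell : ℝ) = ((n + 1).bell : ℝ) :=
  div_mul_cancel₀ _ (cast_bell_pos n).ne'

/-- The Bell numbers are log-convex: `∑ⱼ jⁿ (j - r)² / j!` is nonnegative. -/
lemma bellRatio_le_succ (n : ℕ) : bellRatio n ≤ bellRatio (n + 1) := by
  set r := bellRatio n with hr
  have h := ((hasSum_pow_div_factorial (n + 2)).sub
    ((hasSum_pow_div_factorial (n + 1)).mul_left (2 * r))).add
    ((hasSum_pow_div_factorial n).mul_left (r ^ 2))
  have hnn := h.nonneg fun j => by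
    have : (j : ℝ) ^ (n + 2) / (j.factorial : ℝ) - 2 * r * ((j : ℝ) ^ (n + 1) / (j.factorial : ℝ)) +
        r ^ 2 * ((j : ℝ) ^ n / (j.factorial : ℝ)) =
        (j : ℝ) ^ n * ((j : ℝ) - r) ^ 2 / (j.factorial : ℝ) := by ring
    rw [this]
    positivity
  have h1 := bellRatio_mul_bell n
  have h2 := bellRatio_mul_bell (n + 1)
  have hfac : Real.exp 1 * ((n + 2).bell : ℝ) - 2 * r * (Real.exp 1 * ((n + 1).bell : ℝ)) +
      r ^ 2 * (Real.exp 1 * (n.bell : ℝ)) =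
      Real.exp 1 * ((n + 1).bell : ℝ) * (bellRatio (n + 1) - r) := by
    rw [show n + 2 = n + 1 + 1 from rfl, ← h2, ← h1]
    ring
  rw [hfac] at hnn
  have := nonneg_of_mul_nonneg_right hnn (mul_pos (Real.exp_pos 1) (cast_bell_pos (n + 1)))
  linarith

lemma monotone_bellRatio : Monotone bellRatio := monotone_nat_of_le_succ bellRatio_le_succ

lemma bell_succ_le_bellRatio_mul {m n : ℕ} (h : m ≤ n) :
    ((m + 1).bell : ℝ) ≤ bellRatio n * (m.bell : ℝ) := by
  rw [← bellRatio_mul_bell m]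
  exact mul_le_mul_of_nonneg_right (monotone_bellRatio h) (cast_bell_pos m).le

lemma cast_bell_succ (n : ℕ) : ((n + 1).bell : ℝ) =
    ∑ k ∈ Finset.range (n + 1), (n.choose k : ℝ) * ((n - k).bell : ℝ) := by
  rw [Nat.bell_succ, ← Nat.range_succ_eq_Iic]
  push_cast
  rfl

lemma cast_bell_add_two (n : ℕ) : ((n + 2).bell : ℝ) = ((n + 1).bell : ℝ) +
    ∑ k ∈ Finset.range (n + 1), (n.choose k : ℝ) * ((n - k + 1).bell : ℝ) := by
  have h := dobinskiSum_succ n 1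
  rw [dobinskiSum_one_right, dobinskiSum_one_right, dobinskiSum_add] at h
  simp only [dobinskiSum_one_right, one_pow, one_mul] at h
  have h' : Complex.exp 1 * ((n + 2).bell : ℂ) = Complex.exp 1 * (((n + 1).bell : ℂ) +
      ∑ k ∈ Finset.range (n + 1), (n.choose k : ℂ) * ((n - k + 1).bell : ℂ)) := by
    rw [h, mul_add, Finset.mul_sum]
    refine congrArg _ (Finset.sum_congr rfl fun k _ => by ring)
  exact_mod_cast mul_left_cancel₀ (Complex.exp_ne_zero 1) h'

/-- The ratios grow by at most one: `Bₙ₊₂ - Bₙ₊₁ = ∑ₖ C(n, k) Bₖ₊₁`, while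
`Bₙ₊₁ = ∑ₖ C(n, k) Bₖ`, and the ratio of corresponding terms is at most `Bₙ₊₁ / Bₙ`. -/
lemma bellRatio_succ_le (n : ℕ) : bellRatio (n + 1) ≤ bellRatio n + 1 := by
  refine (div_le_iff₀ (cast_bell_pos (n + 1))).2 ?_
  rw [cast_bell_add_two, add_mul, one_mul, add_comm]
  gcongr
  rw [cast_bell_succ n, Finset.mul_sum]
  refine Finset.sum_le_sum fun k _ => ?_
  have := mul_le_mul_of_nonneg_left (bell_succ_le_bellRatio_mul (Nat.sub_le n k))
    (Nat.cast_nonneg (α := ℝ) (n.choose k))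
  linarith

lemma bell_le_bellRatio_pow_mul {n k : ℕ} (h : k ≤ n) :
    (n.bell : ℝ) ≤ bellRatio n ^ k * ((n - k).bell : ℝ) := by
  induction k with
  | zero => simp
  | succ k ih =>
    refine (ih (by omega)).trans ?_
    have h1 := bell_succ_le_bellRatio_mul (Nat.sub_le n (k + 1))
    rw [show n - (k + 1) + 1 = n - k by omega] at h1
    rw [pow_succ, mul_assoc]
    exact mul_le_mul_of_nonneg_left h1 (pow_nonneg (bellRatio_pos n).le k)

lemma one_add_inv_bellRatio_pow_le (n : ℕ) : (1 + (bellRatio n)⁻¹) ^ n ≤ bellRatio n := by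
  have hr := bellRatio_pos n
  refine (le_div_iff₀ (cast_bell_pos n)).2 ?_
  rw [cast_bell_succ, add_comm, add_pow, Finset.sum_mul]
  refine Finset.sum_le_sum fun k hk => ?_
  have h := bell_le_bellRatio_pow_mul (Nat.lt_succ_iff.1 (Finset.mem_range.1 hk))
  have h' : ((bellRatio n)⁻¹) ^ k * (n.bell : ℝ) ≤ ((n - k).bell : ℝ) := by
    rw [inv_pow, inv_mul_le_iff₀ (pow_pos hr k)]
    exact h
  calc _ = (n.choose k : ℝ) * ((bellRatio n)⁻¹ ^ k * (n.bell : ℝ)) := by ring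
    _ ≤ _ := by gcongr

lemma two_le_bellRatio {n : ℕ} (hn : 1 ≤ n) : 2 ≤ bellRatio n := by
  refine le_trans ?_ (monotone_bellRatio hn)
  norm_num [bellRatio]

lemma hasSum_succ_pow_div_succ {n : ℕ} (hn : 1 ≤ n) :
    HasSum (fun j : ℕ => ((j : ℝ) + 1) ^ n / (j.factorial : ℝ) * ((j : ℝ) + 1)⁻¹)
      (Real.exp 1 * (n.bell : ℝ)) := by
  obtain ⟨m, rfl⟩ := Nat.exists_eq_add_of_le' hn
  refine (hasSum_succ_pow_div_factorial m).congr_fun fun j => ?_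
  have : (j : ℝ) + 1 ≠ 0 := by positivity
  field_simp
  ring

lemma hasSum_succ_pow_div_succ_sq {n : ℕ} (hn : 2 ≤ n) :
    HasSum (fun j : ℕ => ((j : ℝ) + 1) ^ n / (j.factorial : ℝ) * (((j : ℝ) + 1)⁻¹) ^ 2)
      (Real.exp 1 * ((n - 1).bell : ℝ)) := by
  obtain ⟨m, rfl⟩ := Nat.exists_eq_add_of_le' hn
  refine (hasSum_succ_pow_div_factorial m).congr_fun fun j => ?_
  have : (j : ℝ) + 1 ≠ 0 := by positivity
  field_simp
  ring

/-- Jensen's inequality for `x ↦ (1 - x) ^ n` at `x = 1 / (j + 1)`, under the weights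
`(j + 1) ^ n / j!`. -/
lemma one_sub_inv_bellRatio_pow_le {n : ℕ} (hn : 1 ≤ n) :
    (1 - (bellRatio n)⁻¹) ^ n ≤ (bellRatio n)⁻¹ := by
  have hr := two_le_bellRatio hn
  set r := bellRatio n with hrdef
  set a := 1 - r⁻¹ with ha
  have hinv : r⁻¹ ≤ 2⁻¹ := inv_anti₀ (by norm_num) hr
  have ha0 : 0 < a := by rw [ha]; linarith
  have hlow := ((hasSum_succ_pow_div_factorial n).mul_left (a ^ n)).add
    ((((hasSum_succ_pow_div_factorial n).mul_left r⁻¹).sub (hasSum_succ_pow_div_succ hn)).mul_left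
      (n * a ^ (n - 1)))
  have hle := hasSum_le (fun j => ?_) hlow (hasSum_pow_div_factorial n)
  · have h1 := bellRatio_mul_bell n
    rw [← hrdef] at h1
    have hr0 : r ≠ 0 := by linarith
    have hz : r⁻¹ * (Real.exp 1 * ((n + 1).bell : ℝ)) - Real.exp 1 * (n.bell : ℝ) = 0 := by
      rw [← h1]
      field_simp
      ring
    rw [hz, mul_zero, add_zero, ← h1] at hle
    have hpos := mul_pos (Real.exp_pos 1) (cast_bell_pos n)
    rw [← one_div, le_div_iff₀ (by linarith)]
    have : a ^ n * r * (Real.exp 1 * (n.bell : ℝ)) ≤ 1 * (Real.exp 1 * (n.bell : ℝ)) := by linarith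
    exact le_of_mul_le_mul_right this hpos
  · -- the tangent to `x ↦ x ^ n` at `a` lies below the graph
    set y : ℝ := (j : ℝ) + 1 with hy
    have hy0 : 0 < y := by positivity
    have hx0 : 0 ≤ 1 - y⁻¹ := by
      have : y⁻¹ ≤ 1 := inv_le_one_of_one_le₀ (by rw [hy]; linarith [Nat.cast_nonneg (α := ℝ) j])
      linarith
    have hb := one_add_mul_sub_le_pow (R := ℝ) (a := (1 - y⁻¹) / a) (by
      have := div_nonneg hx0 ha0.le; linarith) n
    rw [div_pow, le_div_iff₀ (pow_pos ha0 n)] at hb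
    have hpow : a ^ n = a ^ (n - 1) * a := by rw [← pow_succ, Nat.sub_add_cancel hn]
    have hb' : a ^ n + n * a ^ (n - 1) * (r⁻¹ - y⁻¹) ≤ (1 - y⁻¹) ^ n := by
      refine le_trans (le_of_eq ?_) hb
      rw [hpow]
      have : r⁻¹ = 1 - a := by rw [ha]; ring
      rw [this]
      field_simp
      ring
    have hj : (j : ℝ) ^ n / (j.factorial : ℝ) = y ^ n / (j.factorial : ℝ) * (1 - y⁻¹) ^ n := by
      have : (j : ℝ) = y * (1 - y⁻¹) := by
        rw [mul_sub, mul_inv_cancel₀ hy0.ne', hy]; ring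
      rw [this, mul_pow]; ring
    rw [hj]
    calc _ = y ^ n / (j.factorial : ℝ) * (a ^ n + n * a ^ (n - 1) * (r⁻¹ - y⁻¹)) := by ring
      _ ≤ _ := mul_le_mul_of_nonneg_left hb' (by positivity)

lemma le_bellRatio_add_one_mul_log (n : ℕ) :
    (n : ℝ) ≤ (bellRatio n + 1) * Real.log (bellRatio n) := by
  have hr := bellRatio_pos n
  have h := Real.log_le_log (by positivity) (one_add_inv_bellRatio_pow_le n)
  rw [Real.log_pow] at h
  have hlog := Real.one_sub_inv_le_log_of_pos (x := 1 + (bellRatio n)⁻¹) (by positivity)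
  have heq : 1 - (1 + (bellRatio n)⁻¹)⁻¹ = (bellRatio n + 1)⁻¹ := by field_simp; ring
  rw [heq] at hlog
  have := (mul_le_mul_of_nonneg_left hlog (Nat.cast_nonneg (α := ℝ) n)).trans h
  rw [← div_eq_mul_inv, div_le_iff₀ (by positivity)] at this
  linarith

lemma bellRatio_sub_one_mul_log_le {n : ℕ} (hn : 1 ≤ n) :
    (bellRatio n - 1) * Real.log (bellRatio n) ≤ (n : ℝ) := by
  have hr := two_le_bellRatio hn
  set r := bellRatio n
  have hinv : r⁻¹ ≤ 2⁻¹ := inv_anti₀ (by norm_num) hr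
  have h := Real.log_le_log (pow_pos (by linarith) n) (one_sub_inv_bellRatio_pow_le hn)
  rw [Real.log_pow, Real.log_inv] at h
  have hlog := Real.one_sub_inv_le_log_of_pos (x := 1 - r⁻¹) (by linarith)
  have hr1 : r - 1 ≠ 0 := by linarith
  have heq : 1 - (1 - r⁻¹)⁻¹ = -(r - 1)⁻¹ := by
    have : 1 - r⁻¹ = (r - 1) / r := by field_simp
    rw [this, inv_div]
    field_simp
    ring
  rw [heq] at hlog
  have := (mul_le_mul_of_nonneg_left hlog (Nat.cast_nonneg (α := ℝ) n)).trans h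
  have h2 : Real.log r ≤ n / (r - 1) := by rw [div_eq_mul_inv]; linarith
  rw [le_div_iff₀ (by linarith)] at h2
  linarith

lemma tendsto_bellRatio_atTop : Tendsto bellRatio atTop atTop := by
  refine tendsto_atTop_mono (f := fun n : ℕ => √(n : ℝ) - 1) (fun n => ?_)
    (tendsto_atTop_add_const_right _ _ (Real.tendsto_sqrt_atTop.comp tendsto_natCast_atTop_atTop))
  have hr := bellRatio_pos n
  have h := le_bellRatio_add_one_mul_log n
  have hlog := Real.log_le_sub_one_of_pos hr
  have : √(n : ℝ) ≤ bellRatio n + 1 := by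
    refine Real.sqrt_le_iff.2 ⟨by linarith, h.trans ?_⟩
    rw [sq]
    exact mul_le_mul_of_nonneg_left (by linarith) (by linarith)
  linarith

lemma tendsto_log_bellRatio_atTop : Tendsto (fun n => Real.log (bellRatio n)) atTop atTop :=
  Real.tendsto_log_atTop.comp tendsto_bellRatio_atTop

/-- `n ~ r log r` for `r = Bₙ₊₁ / Bₙ`. -/
lemma tendsto_div_bellRatio_mul_log :
    Tendsto (fun n : ℕ => (n : ℝ) / (bellRatio n * Real.log (bellRatio n))) atTop (𝓝 1) := by
  have hinv := tendsto_inv_atTop_zero.comp tendsto_bellRatio_atTop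
  have hlo : Tendsto (fun n => 1 - (bellRatio n)⁻¹) atTop (𝓝 1) := by
    simpa using tendsto_const_nhds.sub hinv
  have hhi : Tendsto (fun n => 1 + (bellRatio n)⁻¹) atTop (𝓝 1) := by
    simpa using tendsto_const_nhds.add hinv
  refine tendsto_of_tendsto_of_tendsto_of_le_of_le' hlo hhi ?_ ?_
  · filter_upwards [eventually_ge_atTop 1] with n hn
    have hr := two_le_bellRatio hn
    have hl : 0 < Real.log (bellRatio n) := Real.log_pos (by linarith)
    rw [le_div_iff₀ (by positivity)]
    have h := bellRatio_sub_one_mul_log_le hn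
    refine le_trans (le_of_eq ?_) h
    field_simp
  · filter_upwards [eventually_ge_atTop 1] with n hn
    have hr := two_le_bellRatio hn
    have hl : 0 < Real.log (bellRatio n) := Real.log_pos (by linarith)
    rw [div_le_iff₀ (by positivity)]
    refine (le_bellRatio_add_one_mul_log n).trans (le_of_eq ?_)
    field_simp

lemma tendsto_log_succ_div_log_bellRatio :
    Tendsto (fun n : ℕ => Real.log ((n : ℝ) + 1) / Real.log (bellRatio n)) atTop (𝓝 1) := by
  have h1 : Tendsto (fun n : ℕ => ((n : ℝ) + 1) / (bellRatio n * Real.log (bellRatio n))) atTop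
      (𝓝 1) := by
    have := tendsto_div_bellRatio_mul_log.add (tendsto_inv_atTop_zero.comp
      (tendsto_bellRatio_atTop.atTop_mul_atTop₀ tendsto_log_bellRatio_atTop))
    rw [add_zero] at this
    refine this.congr fun n => ?_
    simp only [Function.comp]
    rw [add_div, one_div]
  have h2 : Tendsto (fun n : ℕ =>
      Real.log (((n : ℝ) + 1) / (bellRatio n * Real.log (bellRatio n))) / Real.log (bellRatio n))
      atTop (𝓝 0) :=
    ((Real.continuousAt_log one_ne_zero).tendsto.comp h1).div_atTop tendsto_log_bellRatio_atTop
  have h3 : Tendsto (fun n => Real.log (Real.log (bellRatio n)) / Real.log (bellRatio n)) atTop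
      (𝓝 0) := by
    have := Real.isLittleO_log_id_atTop.tendsto_div_nhds_zero.comp tendsto_log_bellRatio_atTop
    exact this
  have h := (h2.add h3).add_const 1
  rw [add_zero, zero_add] at h
  refine h.congr' ?_
  filter_upwards [eventually_ge_atTop 1] with n hn
  have hr := two_le_bellRatio hn
  have hl : 0 < Real.log (bellRatio n) := Real.log_pos (by linarith)
  rw [Real.log_div (by positivity) (by positivity), Real.log_mul (by positivity) hl.ne']
  field_simp
  ring

/-- `n Bₙ / Bₙ₊₁ ~ log n`. -/
lemma tendsto_div_bellRatio_div_log :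
    Tendsto (fun n : ℕ => (n : ℝ) / bellRatio n / Real.log ((n : ℝ) + 1)) atTop (𝓝 1) := by
  have h := tendsto_div_bellRatio_mul_log.div tendsto_log_succ_div_log_bellRatio one_ne_zero
  rw [div_one] at h
  refine h.congr' ?_
  filter_upwards [eventually_ge_atTop 1] with n hn
  have hr := two_le_bellRatio hn
  have hl : 0 < Real.log (bellRatio n) := Real.log_pos (by linarith)
  have hl' : 0 < Real.log ((n : ℝ) + 1) := Real.log_pos (by
    have : (1 : ℝ) ≤ n := by exact_mod_cast hn
    linarith)
  simp only [Pi.div_apply]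
  field_simp

/-! ### Mean and variance of the number of levels -/

/-- For `n ≥ 2`, the variance of `1 / (J + 1)` when `J` has weights proportional to
`(j + 1) ^ n / j!`. -/
noncomputable def invVariance (n : ℕ) : ℝ :=
  ((n - 1).bell : ℝ) / ((n + 1).bell : ℝ) - ((bellRatio n)⁻¹) ^ 2

lemma invVariance_eq {n : ℕ} (hn : 1 ≤ n) :
    invVariance n = (bellRatio n - bellRatio (n - 1)) / (bellRatio n ^ 2 * bellRatio (n - 1)) := by
  obtain ⟨m, rfl⟩ := Nat.exists_eq_add_of_le' hn
  have h0 := (bellRatio_pos m).ne'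
  have h1 := (bellRatio_pos (m + 1)).ne'
  have hb := (cast_bell_pos m).ne'
  rw [invVariance, Nat.add_sub_cancel, ← bellRatio_mul_bell (m + 1), ← bellRatio_mul_bell m]
  field_simp

lemma invVariance_nonneg {n : ℕ} (hn : 1 ≤ n) : 0 ≤ invVariance n := by
  rw [invVariance_eq hn]
  have := monotone_bellRatio (Nat.sub_le n 1)
  have := bellRatio_pos n
  have := bellRatio_pos (n - 1)
  exact div_nonneg (by linarith) (by positivity)

lemma tendsto_sq_mul_invVariance :
    Tendsto (fun n : ℕ => (n : ℝ) ^ 2 * invVariance n) atTop (𝓝 0) := by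
  have hlog : Tendsto (fun n => Real.log (bellRatio n) ^ 2 / bellRatio n) atTop (𝓝 0) :=
    (Real.isLittleO_pow_log_id_atTop (n := 2)).tendsto_div_nhds_zero.comp tendsto_bellRatio_atTop
  have hub := ((tendsto_div_bellRatio_mul_log.pow 2).mul hlog).const_mul 2
  rw [mul_zero, mul_zero] at hub
  refine tendsto_of_tendsto_of_tendsto_of_le_of_le' tendsto_const_nhds hub ?_ ?_
  · filter_upwards [eventually_ge_atTop 1] with n hn
    exact mul_nonneg (sq_nonneg _) (invVariance_nonneg hn)
  · filter_upwards [eventually_ge_atTop 1] with n hn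
    have hr := two_le_bellRatio hn
    have hl : 0 < Real.log (bellRatio n) := Real.log_pos (by linarith)
    have hstep : bellRatio n ≤ bellRatio (n - 1) + 1 := by
      have := bellRatio_succ_le (n - 1)
      rwa [Nat.sub_add_cancel hn] at this
    have hq : 0 < bellRatio (n - 1) := bellRatio_pos _
    have hV : invVariance n ≤ 2 / bellRatio n ^ 3 := by
      rw [invVariance_eq hn, div_le_div_iff₀ (by positivity) (by positivity)]
      have h1 : bellRatio n ≤ 2 * bellRatio (n - 1) := by linarith
      calc (bellRatio n - bellRatio (n - 1)) * bellRatio n ^ 3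
          ≤ 1 * bellRatio n ^ 3 := by gcongr; linarith
        _ = bellRatio n ^ 2 * bellRatio n := by ring
        _ ≤ bellRatio n ^ 2 * (2 * bellRatio (n - 1)) := by gcongr
        _ = _ := by ring
    refine (mul_le_mul_of_nonneg_left hV (sq_nonneg _)).trans (le_of_eq ?_)
    field_simp

namespace SetPartition

instance instIsProbabilityMeasure (n : ℕ) : IsProbabilityMeasure (uniform n) :=
  isProbabilityMeasure_uniformOn Set.finite_univ Set.univ_nonempty

lemma integral_uniform {E : Type*} [NormedAddCommGroup E] [NormedSpace ℝ E] [CompleteSpace E]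
    (N : ℕ)
    (f : SetPartition (N + 1) → E) :
    ∫ p, f p ∂(uniform (N + 1)) = ((N + 1).bell : ℝ)⁻¹ • ∑ p, f p := by
  rw [uniform, uniformOn, ProbabilityTheory.cond, integral_smul_measure, Measure.restrict_univ,
    integral_count, Measure.count_univ, ENat.card_eq_coe_fintype_card, card_eq_bell]
  simp

lemma levelsMean_succ (N : ℕ) : levelsMean (N + 1) = (N : ℝ) / bellRatio N := by
  have h := sum_choose_levels N 1
  simp only [Nat.choose_one_right] at h
  rw [levelsMean, integral_uniform, h, smul_eq_mul, bellRatio, div_div_eq_mul_div]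
  rcases N with _ | N
  · simp
  · rw [Nat.add_sub_cancel]
    ring

lemma sum_levels_sq (N : ℕ) :
    ∑ p : SetPartition (N + 1), (p.levels : ℝ) ^ 2 =
      N * (N.bell : ℝ) + N * (N - 1) * ((N - 1).bell : ℝ) := by
  have h1 := sum_choose_levels N 1
  have h2 := sum_choose_levels N 2
  simp only [Nat.choose_one_right, Nat.cast_choose_two] at h1 h2
  have hsplit : ∑ p : SetPartition (N + 1), (p.levels : ℝ) ^ 2 =
      ∑ p : SetPartition (N + 1), (p.levels : ℝ) +
        2 * ∑ p : SetPartition (N + 1), (p.levels : ℝ) * ((p.levels : ℝ) - 1) / 2 := by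
    rw [Finset.mul_sum, ← Finset.sum_add_distrib]
    exact Finset.sum_congr rfl fun p _ => by ring
  rw [hsplit, h1, h2]
  rcases N with _ | _ | N
  · simp
  · simp
  · simp only [show N + 1 + 1 - 1 = N + 1 from rfl,
      show N + 1 + 1 - 2 = N from rfl]
    ring

lemma levelsVar_succ (N : ℕ) : levelsVar (N + 1) =
    ((N : ℝ) * (N.bell : ℝ) + N * (N - 1) * ((N - 1).bell : ℝ)) / ((N + 1).bell : ℝ) -
      ((N : ℝ) / bellRatio N) ^ 2 := by
  have hmean : ∫ p : SetPartition (N + 1), (p.levels : ℝ) ∂(uniform (N + 1)) =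
      (N : ℝ) / bellRatio N := levelsMean_succ N
  rw [levelsVar, variance_eq_sub MemLp.of_discrete, hmean]
  simp only [Pi.pow_apply]
  rw [integral_uniform, sum_levels_sq, smul_eq_mul, inv_mul_eq_div]

/-- The law of total variance for the mixture of binomial laws `Bin(N, 1 / (J + 1))`. -/
lemma levelsVar_succ_eq (N : ℕ) : levelsVar (N + 1) =
    (N : ℝ) / bellRatio N * (1 - (bellRatio N)⁻¹) + N * (N - 1) * invVariance N := by
  have := (cast_bell_pos N).ne'
  have := (cast_bell_pos (N + 1)).ne'
  rw [levelsVar_succ, invVariance, bellRatio]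
  field_simp
  ring

lemma tendsto_levelsMean_succ_div_log :
    Tendsto (fun N : ℕ => levelsMean (N + 1) / Real.log ((N : ℝ) + 1)) atTop (𝓝 1) := by
  simp only [levelsMean_succ]
  exact tendsto_div_bellRatio_div_log

lemma tendsto_log_natCast_succ_atTop : Tendsto (fun N : ℕ => Real.log ((N : ℝ) + 1)) atTop atTop :=
  Real.tendsto_log_atTop.comp (tendsto_atTop_add_const_right _ _ tendsto_natCast_atTop_atTop)

lemma tendsto_levelsMean_succ_atTop : Tendsto (fun N : ℕ => levelsMean (N + 1)) atTop atTop := by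
  have h := tendsto_levelsMean_succ_div_log.pos_mul_atTop one_pos tendsto_log_natCast_succ_atTop
  refine h.congr' ?_
  filter_upwards [tendsto_log_natCast_succ_atTop.eventually_gt_atTop 0] with N hN
  field_simp

lemma tendsto_levelsVar_succ_div_levelsMean :
    Tendsto (fun N : ℕ => levelsVar (N + 1) / levelsMean (N + 1)) atTop (𝓝 1) := by
  have hinv := tendsto_inv_atTop_zero.comp tendsto_bellRatio_atTop
  have hn : Tendsto (fun N : ℕ => (N : ℝ)⁻¹) atTop (𝓝 0) :=
    tendsto_inv_atTop_zero.comp tendsto_natCast_atTop_atTop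
  have h1 : Tendsto (fun N : ℕ => (N : ℝ) * (N - 1) * invVariance N) atTop (𝓝 0) := by
    have := tendsto_sq_mul_invVariance.mul (tendsto_const_nhds (x := (1 : ℝ)) |>.sub hn)
    rw [zero_mul] at this
    refine this.congr' ?_
    filter_upwards [eventually_ge_atTop 1] with N hN
    have : (N : ℝ) ≠ 0 := by positivity
    field_simp
  have h := (tendsto_const_nhds (x := (1 : ℝ)) |>.sub hinv).add
    (h1.div_atTop tendsto_levelsMean_succ_atTop)
  rw [sub_zero, add_zero] at h
  refine h.congr' ?_
  filter_upwards [tendsto_levelsMean_succ_atTop.eventually_gt_atTop 0] with N hN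
  rw [levelsVar_succ_eq, add_div, ← levelsMean_succ, mul_div_cancel_left₀ _ hN.ne']
  rfl

lemma tendsto_levelsVar_succ_div_log :
    Tendsto (fun N : ℕ => levelsVar (N + 1) / Real.log ((N : ℝ) + 1)) atTop (𝓝 1) := by
  have h := tendsto_levelsVar_succ_div_levelsMean.mul tendsto_levelsMean_succ_div_log
  rw [mul_one] at h
  refine h.congr' ?_
  filter_upwards [tendsto_levelsMean_succ_atTop.eventually_gt_atTop 0] with N hN
  field_simp

lemma tendsto_levelsVar_succ_atTop : Tendsto (fun N : ℕ => levelsVar (N + 1)) atTop atTop := by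
  have h := tendsto_levelsVar_succ_div_levelsMean.pos_mul_atTop one_pos
    tendsto_levelsMean_succ_atTop
  refine h.congr' ?_
  filter_upwards [tendsto_levelsMean_succ_atTop.eventually_gt_atTop 0] with N hN
  field_simp

/-- Asymptotic equivalence to `log n` may be checked after the shift `n = N + 1`. -/
lemma isEquivalent_log_of_tendsto {f : ℕ → ℝ}
    (h : Tendsto (fun N : ℕ => f (N + 1) / Real.log ((N : ℝ) + 1)) atTop (𝓝 1)) :
    f ~[atTop] fun n : ℕ => Real.log (n : ℝ) := by
  refine (isEquivalent_iff_tendsto_one ?_).2 ?_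
  · filter_upwards [eventually_ge_atTop 2] with n hn
    exact (Real.log_pos (by exact_mod_cast hn)).ne'
  · rw [← tendsto_add_atTop_iff_nat 1]
    simpa using h

end SetPartition

/-! ### The central limit theorem -/

lemma norm_pow_sub_pow_le_mul {a b : ℂ} (ha : ‖a‖ ≤ 1) (hb : ‖b‖ ≤ 1) (n : ℕ) :
    ‖a ^ n - b ^ n‖ ≤ n * ‖a - b‖ := by
  induction n with
  | zero => simp
  | succ n ih =>
    calc ‖a ^ (n + 1) - b ^ (n + 1)‖ = ‖a ^ n * (a - b) + (a ^ n - b ^ n) * b‖ := by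
          congr 1; ring
      _ ≤ ‖a ^ n‖ * ‖a - b‖ + ‖a ^ n - b ^ n‖ * ‖b‖ := by
          rw [← norm_mul, ← norm_mul]; exact norm_add_le _ _
      _ ≤ 1 * ‖a - b‖ + (n * ‖a - b‖) * 1 := by
          gcongr
          rw [norm_pow]
          exact pow_le_one₀ (norm_nonneg _) ha
      _ = _ := by push_cast; ring

lemma norm_one_add_sub_one_mul_le {z : ℂ} (hz : ‖z‖ ≤ 1) {x : ℝ} (h0 : 0 ≤ x) (h1 : x ≤ 1) :
    ‖1 + (z - 1) * (x : ℂ)‖ ≤ 1 := by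
  have h : 1 + (z - 1) * (x : ℂ) = ((1 - x : ℝ) : ℂ) + (x : ℂ) * z := by push_cast; ring
  rw [h]
  refine (norm_add_le _ _).trans ?_
  rw [norm_mul, Complex.norm_of_nonneg h0, Complex.norm_of_nonneg (by linarith)]
  nlinarith

lemma hasSum_weighted_sq_sub_inv_bellRatio {n : ℕ} (hn : 2 ≤ n) :
    HasSum (fun j : ℕ => ((j : ℝ) + 1) ^ n / (j.factorial : ℝ) *
      (((j : ℝ) + 1)⁻¹ - (bellRatio n)⁻¹) ^ 2)
      (Real.exp 1 * ((n + 1).bell : ℝ) * invVariance n) := by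
  have h := ((hasSum_succ_pow_div_succ_sq hn).sub
    ((hasSum_succ_pow_div_succ (by omega : 1 ≤ n)).mul_left (2 * (bellRatio n)⁻¹))).add
    ((hasSum_succ_pow_div_factorial n).mul_left ((bellRatio n)⁻¹ ^ 2))
  have h0 := (cast_bell_pos n).ne'
  have h1 := (cast_bell_pos (n + 1)).ne'
  have heq : Real.exp 1 * ((n + 1).bell : ℝ) * invVariance n =
      Real.exp 1 * ((n - 1).bell : ℝ) - 2 * (bellRatio n)⁻¹ * (Real.exp 1 * (n.bell : ℝ)) +
        (bellRatio n)⁻¹ ^ 2 * (Real.exp 1 * ((n + 1).bell : ℝ)) := by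
    rw [invVariance, bellRatio]
    field_simp
    ring
  rw [heq]
  exact h.congr_fun fun j => by ring

namespace SetPartition

/-- The number of levels is a mixture of binomial laws `Bin(N, 1 / (J + 1))`, and its generating
function is close to that of the single binomial law with the mean success probability. Here `δ`
bounds `|x|` through `|x| ≤ (δ + x² / δ) / 2`. -/
lemma norm_sum_pow_levels_sub_le {N : ℕ} (hN : 2 ≤ N) {z : ℂ} (hz : ‖z‖ ≤ 1) {δ : ℝ}
    (hδ : 0 < δ) :
    ‖((N + 1).bell : ℂ)⁻¹ * ∑ p : SetPartition (N + 1), z ^ p.levels -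
        (1 + (z - 1) * ((bellRatio N)⁻¹ : ℝ)) ^ N‖ ≤
      N * ‖z - 1‖ * ((δ + invVariance N / δ) / 2) := by
  set q : ℝ := (bellRatio N)⁻¹ with hq
  have hr := two_le_bellRatio (show 1 ≤ N by omega)
  have hq0 : 0 ≤ q := inv_nonneg.2 (by linarith)
  have hq1 : q ≤ 1 := inv_le_one_of_one_le₀ (by linarith)
  set T : ℂ := (1 + (z - 1) * (q : ℂ)) ^ N with hT
  have hB := cast_bell_pos (N + 1)
  have hBC : ((N + 1).bell : ℂ) ≠ 0 := by exact_mod_cast hB.ne'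
  have hS : Complex.exp 1 * ∑ p : SetPartition (N + 1), z ^ p.levels = dobinskiSum N z := by
    have := sum_pow_levels N (z - 1)
    rwa [add_sub_cancel] at this
  have hsum := (hasSum_dobinskiSum N z).sub ((hasSum_dobinskiSum N 1).mul_right T)
  have hbound := (((hasSum_succ_pow_div_factorial N).mul_right (δ / 2)).add
    ((hasSum_weighted_sq_sub_inv_bellRatio hN).mul_right (1 / (2 * δ)))).mul_left (N * ‖z - 1‖)
  have hle := tsum_of_norm_bounded hbound (f := fun j : ℕ =>
    ((j : ℂ) + z) ^ N / (j.factorial : ℂ) - ((j : ℂ) + 1) ^ N / (j.factorial : ℂ) * T)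
    (fun j => ?_)
  · rw [hsum.tsum_eq, ← hS, dobinskiSum_one_right] at hle
    have hfac : Complex.exp 1 * ∑ p : SetPartition (N + 1), z ^ p.levels -
        Complex.exp 1 * ((N + 1).bell : ℂ) * T = ((Real.exp 1 * ((N + 1).bell : ℝ) : ℝ) : ℂ) *
        (((N + 1).bell : ℂ)⁻¹ * ∑ p : SetPartition (N + 1), z ^ p.levels - T) := by
      push_cast
      field_simp
    rw [hfac, norm_mul, Complex.norm_of_nonneg (by positivity)] at hle
    refine le_of_mul_le_mul_left (hle.trans (le_of_eq ?_)) (mul_pos (Real.exp_pos 1) hB)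
    field_simp
  · set y : ℝ := (j : ℝ) + 1 with hy
    have hy1 : 1 ≤ y := by rw [hy]; linarith [Nat.cast_nonneg (α := ℝ) j]
    have hy0 : (y : ℂ) ≠ 0 := by exact_mod_cast (by linarith : y ≠ 0)
    have hjy : (j : ℂ) + 1 = (y : ℂ) := by rw [hy]; push_cast; rfl
    have hterm : ((j : ℂ) + z) ^ N / (j.factorial : ℂ) -
        ((j : ℂ) + 1) ^ N / (j.factorial : ℂ) * T =
        ((y ^ N / (j.factorial : ℝ) : ℝ) : ℂ) * ((1 + (z - 1) * ((y⁻¹ : ℝ) : ℂ)) ^ N - T) := by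
      have hjz : (j : ℂ) + z = (y : ℂ) * (1 + (z - 1) * ((y⁻¹ : ℝ) : ℂ)) := by
        push_cast
        rw [mul_add, mul_comm (z - 1), ← mul_assoc, mul_inv_cancel₀ hy0, ← hjy]
        ring
      rw [hjz, hjy, mul_pow]
      push_cast
      ring
    have habs : |y⁻¹ - q| ≤ δ / 2 + (y⁻¹ - q) ^ 2 * (1 / (2 * δ)) := by
      have h1 := sq_nonneg (|y⁻¹ - q| - δ)
      have h2 := sq_abs (y⁻¹ - q)
      have h3 : δ / 2 + (y⁻¹ - q) ^ 2 * (1 / (2 * δ)) = (δ ^ 2 + (y⁻¹ - q) ^ 2) / (2 * δ) := by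
        field_simp
      rw [h3, le_div_iff₀ (by positivity)]
      nlinarith
    rw [hterm, norm_mul, Complex.norm_of_nonneg (by positivity)]
    have hpow := norm_pow_sub_pow_le_mul
      (norm_one_add_sub_one_mul_le hz (inv_nonneg.2 (by linarith)) (inv_le_one_of_one_le₀ hy1))
      (norm_one_add_sub_one_mul_le hz hq0 hq1) N
    have hdiff : 1 + (z - 1) * ((y⁻¹ : ℝ) : ℂ) - (1 + (z - 1) * (q : ℂ)) =
        (z - 1) * ((y⁻¹ - q : ℝ) : ℂ) := by push_cast; ring
    rw [hdiff, norm_mul, Complex.norm_real, Real.norm_eq_abs] at hpow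
    calc _ ≤ y ^ N / (j.factorial : ℝ) *
          (N * (‖z - 1‖ * (δ / 2 + (y⁻¹ - q) ^ 2 * (1 / (2 * δ))))) :=
          mul_le_mul_of_nonneg_left (hpow.trans (by gcongr)) (by positivity)
      _ = _ := by ring

end SetPartition

/-- The characteristic function of a centred Bernoulli variable, to second order. -/
lemma norm_bernoulli_taylor_le {p s : ℝ} (h0 : 0 ≤ p) (h1 : p ≤ 1) (hs : |s| ≤ 1) :
    ‖Complex.exp (-(s * p : ℝ) * Complex.I) * (1 + (Complex.exp (s * Complex.I) - 1) * (p : ℂ)) - 1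
        + ((p * (1 - p) * s ^ 2 / 2 : ℝ) : ℂ)‖ ≤ 2 * p * |s| ^ 3 := by
  have taylor : ∀ θ : ℝ, |θ| ≤ 1 →
      ‖Complex.exp (θ * Complex.I) - (1 + θ * Complex.I - ((θ ^ 2 / 2 : ℝ) : ℂ))‖ ≤ |θ| ^ 3 := by
    intro θ hθ
    have hn : ‖(θ : ℂ) * Complex.I‖ = |θ| := by simp
    have h := Complex.exp_bound (x := θ * Complex.I) (by rw [hn]; exact hθ) (n := 3) (by norm_num)
    rw [hn] at h
    have he : ∑ m ∈ Finset.range 3, ((θ : ℂ) * Complex.I) ^ m / (m.factorial : ℂ) =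
        1 + θ * Complex.I - ((θ ^ 2 / 2 : ℝ) : ℂ) := by
      simp [Finset.sum_range_succ, mul_pow, Nat.factorial]
      ring
    rw [he] at h
    refine h.trans (mul_le_of_le_one_right (by positivity) ?_)
    norm_num [Nat.factorial]
  have hps : |-(s * p)| ≤ 1 := by
    rw [abs_neg, abs_mul, abs_of_nonneg h0]
    nlinarith [abs_nonneg s]
  have hps' : |s * (1 - p)| ≤ 1 := by
    rw [abs_mul, abs_of_nonneg (by linarith : 0 ≤ 1 - p)]
    nlinarith [abs_nonneg s]
  have hA := taylor _ hps
  have hB := taylor _ hps'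
  have hsplit : Complex.exp (-(s * p : ℝ) * Complex.I) *
      (1 + (Complex.exp (s * Complex.I) - 1) * (p : ℂ)) - 1 +
        ((p * (1 - p) * s ^ 2 / 2 : ℝ) : ℂ) =
      ((1 - p : ℝ) : ℂ) * (Complex.exp ((-(s * p) : ℝ) * Complex.I) -
        (1 + ((-(s * p) : ℝ) : ℂ) * Complex.I - (((-(s * p)) ^ 2 / 2 : ℝ) : ℂ))) +
      (p : ℂ) * (Complex.exp ((s * (1 - p) : ℝ) * Complex.I) -
        (1 + ((s * (1 - p) : ℝ) : ℂ) * Complex.I - (((s * (1 - p)) ^ 2 / 2 : ℝ) : ℂ))) := by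
    have hexp : Complex.exp ((s * (1 - p) : ℝ) * Complex.I) =
        Complex.exp ((-(s * p) : ℝ) * Complex.I) * Complex.exp (s * Complex.I) := by
      rw [← Complex.exp_add]
      congr 1
      push_cast
      ring
    rw [hexp]
    push_cast
    ring
  rw [hsplit]
  refine (norm_add_le _ _).trans ?_
  rw [norm_mul, norm_mul, Complex.norm_of_nonneg h0, Complex.norm_of_nonneg (by linarith)]
  have hsp : |-(s * p)| ^ 3 ≤ p * |s| ^ 3 := by
    rw [abs_neg, abs_mul, abs_of_nonneg h0, mul_pow, mul_comm]
    gcongr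
    exact pow_le_of_le_one h0 h1 (by norm_num)
  have hsp' : |s * (1 - p)| ^ 3 ≤ |s| ^ 3 := by
    rw [abs_mul, abs_of_nonneg (by linarith : 0 ≤ 1 - p)]
    gcongr
    nlinarith [abs_nonneg s]
  calc _ ≤ 1 * (p * |s| ^ 3) + p * |s| ^ 3 := by
        gcongr
        · linarith
        · exact hA.trans hsp
        · exact hB.trans hsp'
    _ = _ := by ring

/-- The central limit theorem for binomial laws `Bin(n, pₙ)` with `n pₙ (1 - pₙ) sₙ² → t²`, in terms
of characteristic functions. -/
lemma tendsto_binomial_charFun {p s : ℕ → ℝ} {t : ℝ} (h0 : ∀ n, 0 ≤ p n)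
    (hp : Tendsto p atTop (𝓝 0)) (hs : Tendsto s atTop (𝓝 0))
    (hv : Tendsto (fun n : ℕ => n * p n * s n ^ 2) atTop (𝓝 (t ^ 2))) :
    Tendsto (fun n : ℕ => (Complex.exp (-(s n * p n : ℝ) * Complex.I) *
      (1 + (Complex.exp (s n * Complex.I) - 1) * (p n : ℂ))) ^ n) atTop
      (𝓝 (Complex.exp (-(t ^ 2 / 2 : ℝ)))) := by
  set a : ℕ → ℂ := fun n => Complex.exp (-(s n * p n : ℝ) * Complex.I) *
      (1 + (Complex.exp (s n * Complex.I) - 1) * (p n : ℂ)) with ha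
  have hmain : Tendsto (fun n : ℕ => ((n * p n * s n ^ 2 * (1 - p n) / 2 : ℝ) : ℂ)) atTop
      (𝓝 ((t ^ 2 / 2 : ℝ) : ℂ)) := by
    refine (Complex.continuous_ofReal.tendsto _).comp ?_
    have := (hv.mul (tendsto_const_nhds (x := (1 : ℝ)) |>.sub hp)).div_const 2
    simpa using this
  have herr : Tendsto (fun n : ℕ => (n : ℂ) * (a n - 1) +
      ((n * p n * s n ^ 2 * (1 - p n) / 2 : ℝ) : ℂ)) atTop (𝓝 0) := by
    have hub := (hv.mul hs.abs).const_mul 2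
    rw [abs_zero, mul_zero, mul_zero] at hub
    refine squeeze_zero_norm' ?_ hub
    filter_upwards [hp.eventually_le_const one_pos,
      hs.abs.eventually_le_const (by rw [abs_zero]; exact one_pos)] with n hpn hsn
    have h := norm_bernoulli_taylor_le (h0 n) hpn hsn
    have heq : (n : ℂ) * (a n - 1) + ((n * p n * s n ^ 2 * (1 - p n) / 2 : ℝ) : ℂ) =
        (n : ℂ) * (a n - 1 + ((p n * (1 - p n) * s n ^ 2 / 2 : ℝ) : ℂ)) := by
      push_cast; ring
    rw [heq, norm_mul, Complex.norm_natCast]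
    refine (mul_le_mul_of_nonneg_left h (Nat.cast_nonneg n)).trans (le_of_eq ?_)
    rw [← sq_abs (s n)]
    ring
  have hlim : Tendsto (fun n : ℕ => (n : ℂ) * (a n - 1)) atTop (𝓝 (-((t ^ 2 / 2 : ℝ) : ℂ))) := by
    have := herr.sub hmain
    rw [zero_sub] at this
    refine this.congr fun n => by ring
  refine (Complex.tendsto_one_add_pow_exp_of_tendsto hlim).congr fun n => ?_
  rw [add_sub_cancel]

namespace SetPartition

/-- The standardized number of levels. -/
noncomputable def standardizedLevels (n : ℕ) (p : SetPartition n) : ℝ :=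
  ((p.levels : ℝ) - levelsMean n) / √(levelsVar n)

lemma charFun_standardizedLevels (N : ℕ) (t : ℝ) :
    charFun ((uniform (N + 1)).map (standardizedLevels (N + 1))) t =
      Complex.exp (-(t / √(levelsVar (N + 1)) * (bellRatio N)⁻¹ : ℝ) * Complex.I) ^ N *
        (((N + 1).bell : ℂ)⁻¹ * ∑ p : SetPartition (N + 1),
          Complex.exp ((t / √(levelsVar (N + 1)) : ℝ) * Complex.I) ^ p.levels) := by
  rw [charFun_apply_real, integral_map (by exact Measurable.of_discrete.aemeasurable)
    (by fun_prop), integral_uniform, Complex.real_smul, Finset.mul_sum, Finset.mul_sum,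
    Finset.mul_sum]
  refine Finset.sum_congr rfl fun p _ => ?_
  rw [← Complex.exp_nat_mul, ← Complex.exp_nat_mul, mul_left_comm, ← Complex.exp_add]
  push_cast
  congr 2
  rw [standardizedLevels, levelsMean_succ]
  push_cast
  ring

lemma tendsto_charFun_standardizedLevels (t : ℝ) :
    Tendsto (fun N : ℕ => charFun ((uniform (N + 1)).map (standardizedLevels (N + 1))) t) atTop
      (𝓝 (Complex.exp (-(t ^ 2 / 2 : ℝ)))) := by
  set s : ℕ → ℝ := fun N => t / √(levelsVar (N + 1)) with hsdef
  set q : ℕ → ℝ := fun N => (bellRatio N)⁻¹ with hqdef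
  have hs : Tendsto s atTop (𝓝 0) :=
    (Real.tendsto_sqrt_atTop.comp tendsto_levelsVar_succ_atTop).const_div_atTop t
  have hq : Tendsto q atTop (𝓝 0) := tendsto_inv_atTop_zero.comp tendsto_bellRatio_atTop
  have hv : Tendsto (fun N : ℕ => N * q N * s N ^ 2) atTop (𝓝 (t ^ 2)) := by
    have h := (tendsto_levelsVar_succ_div_levelsMean.inv₀ one_ne_zero).const_mul (t ^ 2)
    rw [inv_one, mul_one] at h
    refine h.congr' ?_
    filter_upwards [tendsto_levelsVar_succ_atTop.eventually_gt_atTop 0] with N hN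
    simp only [hsdef, hqdef]
    rw [div_pow, Real.sq_sqrt hN.le, levelsMean_succ, inv_div]
    ring
  have hbin := tendsto_binomial_charFun (fun N => (inv_pos.2 (bellRatio_pos N)).le) hq hs hv
  refine (tendsto_iff_of_dist ?_).1 hbin
  -- `δ = 1 / N` turns the error bound into `|s| (1 + N² V) / 2`
  have hub := (hs.abs.mul (tendsto_sq_mul_invVariance.const_add 1)).div_const 2
  rw [abs_zero, zero_mul, zero_div] at hub
  refine squeeze_zero' (Eventually.of_forall fun _ => dist_nonneg) ?_ hub
  filter_upwards [eventually_ge_atTop 2] with N hN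
  have hN0 : (0 : ℝ) < N := by exact_mod_cast (by omega : 0 < N)
  have hz : ‖Complex.exp (s N * Complex.I)‖ = 1 := Complex.norm_exp_ofReal_mul_I _
  have hphase : ‖Complex.exp (-(s N * q N : ℝ) * Complex.I)‖ = 1 := by
    rw [← Complex.ofReal_neg]
    exact Complex.norm_exp_ofReal_mul_I _
  have hz1 : ‖Complex.exp (s N * Complex.I) - 1‖ ≤ |s N| := by
    rw [mul_comm]
    exact Real.norm_exp_I_mul_ofReal_sub_one_le
  have h := norm_sum_pow_levels_sub_le hN hz.le (inv_pos.2 hN0)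
  rw [charFun_standardizedLevels, mul_pow, dist_comm, dist_eq_norm, ← mul_sub, norm_mul, norm_pow,
    hphase, one_pow, one_mul]
  refine h.trans ?_
  have hV := invVariance_nonneg (show 1 ≤ N by omega)
  calc _ ≤ N * |s N| * (((N : ℝ)⁻¹ + invVariance N / (N : ℝ)⁻¹) / 2) := by gcongr
    _ = _ := by field_simp

lemma measureReal_gaussianReal_Iic (x : ℝ) : (gaussianReal 0 1).real (Set.Iic x) =
    1 / √(2 * Real.pi) * ∫ τ in Set.Iic x, Real.exp (-τ ^ 2 / 2) := by
  rw [measureReal_def, gaussianReal_apply_eq_integral _ one_ne_zero, ENNReal.toReal_ofReal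
    (integral_nonneg fun _ => gaussianPDFReal_nonneg _ _ _), ← integral_const_mul]
  simp [gaussianPDFReal]

/-- The central limit theorem for the number of levels, from the convergence of the characteristic
functions by Lévy's theorem. -/
lemma tendsto_uniform_standardizedLevels_le (x : ℝ) :
    Tendsto (fun n : ℕ => (uniform n).real {p | standardizedLevels n p ≤ x}) atTop
      (𝓝 ((gaussianReal 0 1).real (Set.Iic x))) := by
  rw [← tendsto_add_atTop_iff_nat 1]
  have hmeas : ∀ n, Measurable (standardizedLevels n) := fun n => Measurable.of_discrete
  let μ : ℕ → ProbabilityMeasure ℝ := fun N =>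
    ⟨(uniform (N + 1)).map (standardizedLevels (N + 1)),
      Measure.isProbabilityMeasure_map (hmeas _).aemeasurable⟩
  let γ : ProbabilityMeasure ℝ := ⟨gaussianReal 0 1, inferInstance⟩
  have hconv : Tendsto μ atTop (𝓝 γ) := by
    refine ProbabilityMeasure.tendsto_of_tendsto_charFun fun t => ?_
    have hγ : charFun (γ : Measure ℝ) t = Complex.exp (-(t ^ 2 / 2 : ℝ)) := by
      change charFun (gaussianReal 0 1) t = _
      rw [charFun_gaussianReal]
      simp
    rw [hγ]
    exact tendsto_charFun_standardizedLevels t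
  have hfr : (γ : Measure ℝ) (frontier (Set.Iic x)) = 0 := by
    rw [frontier_Iic]
    have := nullSingletonClass_gaussianReal (μ := 0) (v := 1) one_ne_zero
    exact measure_singleton (μ := gaussianReal 0 1) x
  have h := ProbabilityMeasure.tendsto_measure_of_null_frontier_of_tendsto' hconv hfr
  have h' := (ENNReal.tendsto_toReal (measure_ne_top (gaussianReal 0 1) (Set.Iic x))).comp h
  refine h'.congr fun N => ?_
  change ((uniform (N + 1)).map (standardizedLevels (N + 1)) (Set.Iic x)).toReal = _
  rw [Measure.map_apply (hmeas _) measurableSet_Iic]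
  rfl

end SetPartition

theorem theorem1p1 :
    -- the mean: exact value and asymptotics
    (∀ n : ℕ, 1 ≤ n →
      SetPartition.levelsMean n = ((n : ℝ) - 1) * ((n - 1).bell : ℝ) / (n.bell : ℝ)) ∧
    (SetPartition.levelsMean ~[atTop] fun n : ℕ => Real.log (n : ℝ)) ∧
    -- the variance: exact value and asymptotics
    -- (for `n = 1` the coefficient of the term with `(n - 2).bell` vanishes)
    (∀ n : ℕ, 1 ≤ n →
      SetPartition.levelsVar n =
        ((n : ℝ) - 1) * ((n - 1).bell : ℝ) / (n.bell : ℝ)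
          + ((n : ℝ) - 1) * ((n : ℝ) - 2) * ((n - 2).bell : ℝ) / (n.bell : ℝ)
          - ((n : ℝ) - 1) ^ 2 * ((n - 1).bell : ℝ) ^ 2 / (n.bell : ℝ) ^ 2) ∧
    (SetPartition.levelsVar ~[atTop] fun n : ℕ => Real.log (n : ℝ)) ∧
    -- the central limit theorem
    (∀ x : ℝ,
      Tendsto
        (fun n : ℕ => (SetPartition.uniform n).real
          {p : SetPartition n |
            ((p.levels : ℝ) - SetPartition.levelsMean n) / √(SetPartition.levelsVar n) ≤ x})
        atTop
        (𝓝 (1 / √(2 * Real.pi) * ∫ τ in Set.Iic x, Real.exp (-τ ^ 2 / 2)))) := by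
  refine ⟨fun n hn => ?_,
    SetPartition.isEquivalent_log_of_tendsto SetPartition.tendsto_levelsMean_succ_div_log,
    fun n hn => ?_,
    SetPartition.isEquivalent_log_of_tendsto SetPartition.tendsto_levelsVar_succ_div_log,
    fun x => ?_⟩
  · obtain ⟨N, rfl⟩ := Nat.exists_eq_add_of_le' hn
    rw [SetPartition.levelsMean_succ, bellRatio, div_div_eq_mul_div, Nat.add_sub_cancel]
    push_cast
    ring
  · obtain ⟨N, rfl⟩ := Nat.exists_eq_add_of_le' hn
    rw [SetPartition.levelsVar_succ, bellRatio, Nat.add_sub_cancel,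
      show N + 1 - 2 = N - 1 by omega]
    have := (cast_bell_pos N).ne'
    have := (cast_bell_pos (N + 1)).ne'
    push_cast
    field_simp
    ring
  · rw [← SetPartition.measureReal_gaussianReal_Iic]
    exact SetPartition.tendsto_uniform_standardizedLevels_le x
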